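/- Theorem 1. Consider $n$ parties connected by authenticated point-to-point channels and proceeding in synchronous rounds. A trusted dealer has set up ideal threshold signatures: for finitely many pairs of a group $Q$ of parties and a threshold $t\ge 1$ chosen by the protocol, every member of $Q$ can sign messages individually, signatures of $t$ distinct members of $Q$ on the same message can be combined into one threshold signature, individual and threshold signatures both have $\kappa\ge 1$ bits, and signatures can be obtained in no other way. Then for every constant $c$ there is a constant $C$, depending only on $c$, such that for all $n$, $f$, $\kappa$ with $f<n/2$ and $\kappa\ge 1$, and every set $V$ of values encoded injectively by bit strings of length at most $c\kappa$, there is a deterministic protocol for inputs in $V$ with the following properties in every execution in which an adaptive, rushing adversary, who sees all messages, corrupts at most $f$ parties in the course of the execution and lets them behave arbitrarily (but cannot forge signatures). Call a party honest if it is never corrupted. 1. (Consistency) If two honest parties decide values $v$ and $v'$, then $v=v'$. 2. (Termination) Every honest party decides a value in $V$ and terminates. 3. (Validity) If all honest parties have the same input value, then all honest parties decide that value. 4. (Communication) The number of bits sent in total by parties while they are not corrupted is at most $C\kappa n^2$. Here the bits of a signed message comprise the signature ($\kappa$ bits), the message that is signed and the name of the key it is signed with. -/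

import Mathlib

namespace ByzAgree

/-- Bit strings. -/
abbrev Bits := List Bool

/-- Trusted setup for ideal threshold signatures among `n` parties. The dealer creates a threshold
key for each of finitely many key names `k`: every party in `members k` holds a key share, and
signatures of `threshold k` distinct members on one message can be combined. A name without members
carries no key. -/
structure ThresholdSetup (n : ℕ) where
  members : Bits → Finset (Fin n)
  threshold : Bits → ℕ
  threshold_pos : ∀ k, 1 ≤ threshold k
  finite_keys : {k | (members k).Nonempty}.Finite

/-- The pieces messages are made of: a plain bit, the message `x` signed by party `r` with its share
of the key named `k`, or the message `x` with a combined threshold signature under the key `k`. -/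
inductive Atom (n : ℕ) where
  | bit (b : Bool) : Atom n
  | share (k : Bits) (r : Fin n) (x : Bits) : Atom n
  | full (k : Bits) (x : Bits) : Atom n

/-- A message is a sequence of pieces. The empty sequence means that nothing is sent. -/
abbrev Msg (n : ℕ) := List (Atom n)

/-- Number of bits of a piece. Individual and combined signatures both have `κ` bits. The message
that is signed and the name of the key are sent along with the signature and are paid for as well,
so that no information can be hidden for free inside a signature. -/
def Atom.size {n : ℕ} (κ : ℕ) : Atom n → ℕ
  | .bit _ => 1
  | .share k _ x => κ + k.length + x.length
  | .full k x => κ + k.length + x.length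

/-- Number of bits of a message. -/
def Msg.size {n : ℕ} (κ : ℕ) (m : Msg n) : ℕ := (m.map (Atom.size κ)).sum

/-- What can be produced by somebody who holds the signing keys of the parties in `A` and has seen
the pieces in `K`: signatures are ideal, so there are no other ways to obtain one. -/
inductive Derivable {n : ℕ} (G : ThresholdSetup n) (A : Set (Fin n)) (K : Set (Atom n)) :
    Atom n → Prop
  | bit (b : Bool) : Derivable G A K (.bit b)
  | known (a : Atom n) : a ∈ K → Derivable G A K a
  | sign (k : Bits) (r : Fin n) (x : Bits) :
      r ∈ A → r ∈ G.members k → Derivable G A K (.share k r x)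
  | combine (k x : Bits) (S : Finset (Fin n)) :
      S ⊆ G.members k → G.threshold k ≤ S.card →
      (∀ r ∈ S, Derivable G A K (.share k r x)) → Derivable G A K (.full k x)

/-- A deterministic synchronous protocol for `n` parties with inputs and decisions in `V`.
In each round every party sends a message to every party, depending on its state, and
then updates its state from the messages it receives. The identity of the sender is known to the
receiver. A party whose state carries a decision has terminated. -/
structure Protocol (n : ℕ) (V : Type) where
  setup : ThresholdSetup n
  State : Type
  init : Fin n → V → State
  send : Fin n → State → Fin n → Msg n
  receive : Fin n → State → (Fin n → Msg n) → State
  decision : Fin n → State → Option V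

namespace Protocol

variable {n : ℕ} {V : Type} (P : Protocol n V)

/-- The message from `p` in state `s` to `q`; a party that has terminated sends nothing. -/
def outgoing (p : Fin n) (s : P.State) (q : Fin n) : Msg n :=
  if (P.decision p s).isSome then [] else P.send p s q

/-- The next state of `p`; a party that has terminated does not change any more. -/
def next (p : Fin n) (s : P.State) (m : Fin n → Msg n) : P.State :=
  if (P.decision p s).isSome then s else P.receive p s m

/-- The executions of `P` on the inputs `input` against an adaptive adversary that corrupts at most
`f` parties in total. `corrupt t` is the set of parties corrupted up to and including round `t`, and
`msg t p q` is the message that `q` receives from `p` in round `t`. The adversary sees all messages,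
is rushing (it sees the messages that the uncorrupted parties send in a round before it chooses
those of the corrupted parties in the same round), and is limited only by the ideality of the
signatures. -/
structure Execution (f : ℕ) (input : Fin n → V) where
  corrupt : ℕ → Finset (Fin n)
  state : ℕ → Fin n → P.State
  msg : ℕ → Fin n → Fin n → Msg n
  corrupt_mono : Monotone corrupt
  corrupt_card : ∀ t, (corrupt t).card ≤ f
  state_zero : ∀ p, state 0 p = P.init p (input p)
  msg_eq : ∀ t p, p ∉ corrupt t → ∀ q, msg t p q = P.outgoing p (state t p) q
  state_succ : ∀ t p, p ∉ corrupt t →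
    state (t + 1) p = P.next p (state t p) (fun q => msg t q p)
  unforgeable : ∀ t p, p ∈ corrupt t → ∀ q, ∀ a ∈ msg t p q,
    Derivable P.setup {r | r ∈ corrupt t}
      {b | ∃ s ≤ t, ∃ r, r ∉ corrupt s ∧ ∃ r', b ∈ msg s r r'} a

variable {P} {f : ℕ} {input : Fin n → V}

/-- A party is honest if it is never corrupted. -/
def Execution.Honest (e : P.Execution f input) (p : Fin n) : Prop :=
  ∀ t, p ∉ e.corrupt t

/-- Party `p` decides the value `v` (and terminates). -/
def Execution.Decides (e : P.Execution f input) (p : Fin n) (v : V) : Prop :=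
  ∃ t, P.decision p (e.state t p) = some v

/-- Number of bits sent in the first `T` rounds by parties that are not corrupted when they send. -/
def Execution.bitsSent (e : P.Execution f input) (κ T : ℕ) : ℕ :=
  ∑ t ∈ Finset.range T, ∑ p ∈ (e.corrupt t)ᶜ, ∑ q, (e.msg t p q).size κ

variable (P)

/-- The parties that follow the protocol are subject to the ideality of signatures, too: in every
execution with at most `f` corruptions they only send what they can produce with their own
signing keys from the messages they have received in earlier rounds. -/
def Realizable (f : ℕ) : Prop :=
  ∀ (input : Fin n → V) (e : P.Execution f input) (t : ℕ) (p : Fin n), p ∉ e.corrupt t →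
    ∀ q, ∀ a ∈ e.msg t p q,
      Derivable P.setup {p} {b | ∃ s < t, ∃ r, b ∈ e.msg s r p} a

/-- `P` solves Byzantine agreement in the presence of at most `f` adaptive corruptions. -/
structure SolvesBA (f : ℕ) : Prop where
  consistency : ∀ (input : Fin n → V) (e : P.Execution f input) (p q : Fin n) (v w : V),
    e.Honest p → e.Honest q → e.Decides p v → e.Decides q w → v = w
  termination : ∀ (input : Fin n → V) (e : P.Execution f input) (p : Fin n),
    e.Honest p → ∃ v, e.Decides p v
  validity : ∀ (input : Fin n → V) (e : P.Execution f input) (v : V),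
    (∀ p, e.Honest p → input p = v) → ∀ p, e.Honest p → e.Decides p v

/-- The communication complexity of `P` with `κ`-bit signatures and at most `f` corruptions is at
most `B` bits. -/
def CommunicationAtMost (f κ B : ℕ) : Prop :=
  ∀ (input : Fin n → V) (e : P.Execution f input) (T : ℕ), e.bitsSent κ T ≤ B

end Protocol

end ByzAgree

/-! Agreement is reached by recursive bisection. A committee runs two phases, one per half. In a
phase all members run graded agreement, the half runs agreement recursively and reports its decision
to the whole committee, and members of grade `0` adopt the majority report. If the committee has an
honest majority, so has one of its halves (`HonestMajority.half`). In the phase of such a half all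
honest members end with a common value: if one of them has a grade, all entered the recursion with
its value, which the half therefore returns; otherwise all adopt the same report (`phase_spec`). The
phase of a bad half does no harm, because graded agreement gives every honest member a grade as soon
as their inputs coincide. So an agreement reached in the first phase survives the second
(`exists_implements_agreement`). Graded agreement (`gradedAgreement_spec`) relies on unforgeability:
a certificate from a strict majority contains a share of an honest signer (`signed_of_mem_msg`).
This says something about the current run only if the key is fresh, so every run has its own key,
and the correctness invariant tracks which keys have been used. A party belongs to one half only, so
its cost obeys a recursion of the form `T(q) ≤ T(⌈q/2⌉) + O(κq)`, up to the slowly growing key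
names. This is linear in `q` (`CostLe.agreement`); summing over the parties gives `O(κn²)`. -/

namespace ByzAgree

/-! ### Bisection of committees and names of keys. -/

open Classical in
/-- The smaller half of a set of parties, and its complement in the set. -/
noncomputable def half {n : ℕ} (Q : Finset (Fin n)) (i : Bool) : Finset (Fin n) :=
  if i then Q \ (Finset.exists_subset_card_eq (Nat.div_le_self Q.card 2)).choose
  else (Finset.exists_subset_card_eq (Nat.div_le_self Q.card 2)).choose

section half

variable {n : ℕ} (Q : Finset (Fin n))

theorem half_false_subset : half Q false ⊆ Q := by
  simpa [half] using (Finset.exists_subset_card_eq (Nat.div_le_self Q.card 2)).choose_spec.1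

theorem card_half_false : (half Q false).card = Q.card / 2 := by
  simpa [half] using (Finset.exists_subset_card_eq (Nat.div_le_self Q.card 2)).choose_spec.2

theorem half_true : half Q true = Q \ half Q false := by simp [half]

theorem half_subset (i : Bool) : half Q i ⊆ Q := by
  cases i
  · exact half_false_subset Q
  · rw [half_true]; exact Finset.sdiff_subset

theorem card_half_true : (half Q true).card = Q.card - Q.card / 2 := by
  rw [half_true, Finset.card_sdiff_of_subset (half_false_subset Q), card_half_false]

theorem card_half_le (i : Bool) : (half Q i).card ≤ Q.card - Q.card / 2 := by
  cases i
  · rw [card_half_false]; omega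
  · rw [card_half_true]

theorem notMem_half_true {p : Fin n} (h : p ∈ half Q false) : p ∉ half Q true := by
  simp [half_true, h]

theorem disjoint_half : Disjoint (half Q false) (half Q true) := by
  rw [half_true]; exact Finset.disjoint_sdiff

theorem half_union : half Q false ∪ half Q true = Q := by
  rw [half_true]; exact Finset.union_sdiff_of_subset (half_false_subset Q)

end half

/-- The committee with a given name in the recursive bisection of all parties. The committee `P` has
the halves `i :: true :: P`, and `i :: false :: P` are further names of the committee `P` itself. -/
noncomputable def committee (n : ℕ) : Bits → Finset (Fin n)
  | i :: true :: P => half (committee n P) i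
  | _ :: false :: P => committee n P
  | _ => Finset.univ

/-- The dealer creates a majority key for every name of a committee of depth at most `n`. -/
noncomputable def majoritySetup (n : ℕ) : ThresholdSetup n where
  members k := if k.length ≤ 2 * n then committee n k else ∅
  threshold k := (if k.length ≤ 2 * n then committee n k else ∅).card / 2 + 1
  threshold_pos k := Nat.succ_pos _
  finite_keys := (List.finite_length_le Bool (2 * n)).subset fun k hk => by
    by_contra h
    have h' : ¬ k.length ≤ 2 * n := h
    simp [h'] at hk

theorem threshold_majoritySetup (n : ℕ) (k : Bits) :
    (majoritySetup n).threshold k = ((majoritySetup n).members k).card / 2 + 1 := rfl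

/-- The two aliases of a committee provide a separate key for each of its two phases, so that no key
serves two graded agreements. -/
theorem members_key {n : ℕ} {P : Bits} (hP : P.length + 2 ≤ 2 * n) (i : Bool) :
    (majoritySetup n).members (i :: false :: P) = (majoritySetup n).members P := by
  have h : P.length ≤ 2 * n := by omega
  simp [majoritySetup, committee, hP, h]

theorem members_child {n : ℕ} {P : Bits} (hP : P.length + 2 ≤ 2 * n) (i : Bool) :
    (majoritySetup n).members (i :: true :: P) = half ((majoritySetup n).members P) i := by
  have h : P.length ≤ 2 * n := by omega
  simp [majoritySetup, committee, hP, h]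

theorem members_nil (n : ℕ) : (majoritySetup n).members [] = Finset.univ := by
  simp [majoritySetup, committee]

/-! ### Programs, their cost and the signatures they may send. -/

/-- The behaviour of one party: it either halts with a decision, or sends a message to every party
and continues depending on the messages received. -/
inductive Program (n : ℕ) (V : Type) where
  | halt (v : V) : Program n V
  | comm (out : Fin n → Msg n) (next : (Fin n → Msg n) → Program n V) : Program n V

namespace Program

variable {n : ℕ} {V : Type}

def out : Program n V → Fin n → Msg n
  | halt _ => fun _ => []
  | comm out _ => out

def step : Program n V → (Fin n → Msg n) → Program n V
  | halt v => fun _ => halt v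
  | comm _ next => next

def result : Program n V → Option V
  | halt v => some v
  | comm _ _ => none

theorem result_eq_some {s : Program n V} {v : V} : s.result = some v ↔ s = halt v := by
  cases s <;> simp [result]

/-- The protocol in which every party runs a program that is determined by its input. -/
abbrev protocol (G : ThresholdSetup n) (start : Fin n → V → Program n V) : Protocol n V where
  setup := G
  State := Program n V
  init := start
  send _ s := s.out
  receive _ s := s.step
  decision _ s := s.result

/-- The program sends at most `b` bits, whatever it receives. -/
def CostLe (κ : ℕ) : Program n V → ℕ → Prop
  | halt _, _ => True
  | comm out next, b => ∃ b', ∑ q, (out q).size κ + b' ≤ b ∧ ∀ m, CostLe κ (next m) b'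

theorem CostLe.mono {κ : ℕ} {s : Program n V} {b c : ℕ} (h : s.CostLe κ b) (hbc : b ≤ c) :
    s.CostLe κ c := by
  cases s with
  | halt v => trivial
  | comm out next =>
    obtain ⟨b', h₁, h₂⟩ := h
    exact ⟨b', h₁.trans hbc, h₂⟩

end Program

/-- The piece `a` is directly available to `p`, who has seen the pieces in `K`. -/
def Available {n : ℕ} (G : ThresholdSetup n) (p : Fin n) (K : Set (Atom n)) : Atom n → Prop
  | .bit _ => True
  | .share k r _ => r = p ∧ p ∈ G.members k
  | .full k x => .full k x ∈ K ∨
      ∃ S ⊆ G.members k, G.threshold k ≤ S.card ∧ ∀ r ∈ S, .share k r x ∈ K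

theorem Available.derivable {n : ℕ} {G : ThresholdSetup n} {p : Fin n} {K : Set (Atom n)}
    {a : Atom n} (h : Available G p K a) : Derivable G {p} K a := by
  cases a with
  | bit b => exact .bit b
  | share k r x => exact .sign k r x h.1 (h.1 ▸ h.2)
  | full k x =>
    rcases h with h | ⟨S, h₁, h₂, h₃⟩
    · exact .known _ h
    · exact .combine k x S h₁ h₂ fun r hr => .known _ (h₃ r hr)

namespace Program

variable {n : ℕ} {V : Type}

/-- Run by `p`, who has seen the pieces in `K`, the program sends only available pieces. -/
def Sound (G : ThresholdSetup n) (p : Fin n) : Set (Atom n) → Program n V → Prop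
  | _, halt _ => True
  | K, comm out next => (∀ q, ∀ a ∈ out q, Available G p K a) ∧
      ∀ m, Sound G p (K ∪ {b | ∃ r, b ∈ m r}) (next m)

theorem Sound.available {G : ThresholdSetup n} {p : Fin n} {K : Set (Atom n)} {s : Program n V}
    (h : s.Sound G p K) {q : Fin n} {a : Atom n} (ha : a ∈ s.out q) : Available G p K a := by
  cases s with
  | halt v => simp [out] at ha
  | comm out next => exact h.1 q a ha

theorem Sound.step {G : ThresholdSetup n} {p : Fin n} {K : Set (Atom n)} {s : Program n V}
    (h : s.Sound G p K) (m : Fin n → Msg n) : (s.step m).Sound G p (K ∪ {b | ∃ r, b ∈ m r}) := by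
  cases s with
  | halt v => trivial
  | comm out next => exact h.2 m

end Program

/-! ### Executions of programs: provenance of signatures and counting of bits. -/

section Execution

open Protocol

variable {n : ℕ} {V : Type} {G : ThresholdSetup n} {start : Fin n → V → Program n V} {f : ℕ}
  {input : Fin n → V} (e : (Program.protocol G start).Execution f input)

theorem msg_eq_out {t : ℕ} {p : Fin n} (hp : p ∉ e.corrupt t) (q : Fin n) :
    e.msg t p q = (e.state t p : Program n V).out q := by
  rw [e.msg_eq t p hp q]
  have hd : (Program.protocol G start).decision p (e.state t p)
    = (e.state t p : Program n V).result := rfl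
  rw [Protocol.outgoing, hd]
  cases h : (e.state t p : Program n V) <;> simp [Program.result, Program.out]

theorem state_succ_eq_step {t : ℕ} {p : Fin n} (hp : p ∉ e.corrupt t) :
    e.state (t + 1) p = (e.state t p : Program n V).step fun q => e.msg t q p := by
  rw [e.state_succ t p hp]
  have hd : (Program.protocol G start).decision p (e.state t p)
    = (e.state t p : Program n V).result := rfl
  rw [Protocol.next, hd]
  cases h : (e.state t p : Program n V) <;> simp [Program.result, Program.step]

theorem msg_eq_of_comm {t : ℕ} {p : Fin n} (hp : p ∉ e.corrupt t) {out : Fin n → Msg n}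
    {next : (Fin n → Msg n) → Program n V} (hs : e.state t p = Program.comm out next)
    (q : Fin n) : e.msg t p q = out q := by
  rw [msg_eq_out e hp, hs]; rfl

theorem state_succ_of_comm {t : ℕ} {p : Fin n} (hp : p ∉ e.corrupt t) {out : Fin n → Msg n}
    {next : (Fin n → Msg n) → Program n V} (hs : e.state t p = Program.comm out next) :
    e.state (t + 1) p = next fun q => e.msg t q p := by
  rw [state_succ_eq_step e hp, hs]; rfl

theorem state_halt {p : Fin n} (hp : e.Honest p) {t : ℕ} {v : V}
    (hs : e.state t p = Program.halt v) {t' : ℕ} (h : t ≤ t') : e.state t' p = Program.halt v := by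
  induction t', h using Nat.le_induction with
  | base => exact hs
  | succ t' _ ih => rw [state_succ_eq_step e (hp t'), ih]; rfl

theorem decides_iff_of_halt {p : Fin n} (hp : e.Honest p) {t : ℕ} {v : V}
    (hs : e.state t p = Program.halt v) {w : V} : e.Decides p w ↔ w = v := by
  constructor
  · rintro ⟨t', ht'⟩
    have h₁ := state_halt e hp (Program.result_eq_some.1 ht') (le_max_left t' t)
    have h₂ := state_halt e hp hs (le_max_right t' t)
    rw [h₁] at h₂
    exact Program.halt.inj h₂
  · rintro rfl
    exact ⟨t, Program.result_eq_some.2 hs⟩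

theorem sound_state (hstart : ∀ p v, (start p v).Sound G p ∅) {t : ℕ} {p : Fin n}
    (hp : p ∉ e.corrupt t) :
    (e.state t p : Program n V).Sound G p {b | ∃ s < t, ∃ r, b ∈ e.msg s r p} := by
  induction t with
  | zero =>
    rw [e.state_zero]
    simpa using hstart p (input p)
  | succ t ih =>
    have hp' : p ∉ e.corrupt t := fun h => hp (e.corrupt_mono (Nat.le_succ t) h)
    rw [state_succ_eq_step e hp']
    convert (ih hp').step fun q => e.msg t q p using 1
    ext b
    simp only [Set.mem_ofPred_eq, Set.mem_union, Nat.lt_succ_iff_lt_or_eq, or_and_right, exists_or,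
      exists_eq_left]

theorem realizable_of_sound (hstart : ∀ p v, (start p v).Sound G p ∅) :
    (Program.protocol G start).Realizable f := by
  intro input e t p hp q a ha
  rw [msg_eq_out e hp] at ha
  exact ((sound_state e hstart hp).available ha).derivable

/-- Induction on the derivation: signing with corrupted keys yields no share of an honest party, and
combining only collects shares that are already accounted for. -/
theorem signed_of_derivable {e : (Program.protocol G start).Execution f input} {t : ℕ}
    {A : Set (Fin n)} {K : Set (Atom n)} (hA : ∀ r ∈ A, ¬ e.Honest r)
    (hshare : ∀ k r x, .share k r x ∈ K → e.Honest r → ∃ s ≤ t, ∃ q, .share k r x ∈ e.msg s r q)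
    (hfull : ∀ k x, .full k x ∈ K → ∃ S ⊆ G.members k, G.threshold k ≤ S.card ∧
      ∀ r ∈ S, e.Honest r → ∃ s ≤ t, ∃ q, .share k r x ∈ e.msg s r q)
    {a : Atom n} (ha : Derivable G A K a) :
    (∀ k r x, a = .share k r x → e.Honest r → ∃ s ≤ t, ∃ q, .share k r x ∈ e.msg s r q) ∧
    (∀ k x, a = .full k x → ∃ S ⊆ G.members k, G.threshold k ≤ S.card ∧
      ∀ r ∈ S, e.Honest r → ∃ s ≤ t, ∃ q, .share k r x ∈ e.msg s r q) := by
  induction ha with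
  | bit b => simp
  | known a ha =>
    exact ⟨fun k r x h => hshare k r x (h ▸ ha), fun k x h => hfull k x (h ▸ ha)⟩
  | sign k r x hr _ =>
    refine ⟨?_, by simp⟩
    rintro _ _ _ ⟨⟩ hr'
    exact absurd hr' (hA r hr)
  | combine k x S hS hcard _ ih =>
    refine ⟨by simp, ?_⟩
    rintro _ _ ⟨⟩
    exact ⟨S, hS, hcard, fun r hr => (ih r hr).1 k r x rfl⟩

/-- Signatures of honest parties come from these parties. -/
theorem signed_of_mem_msg (hstart : ∀ p v, (start p v).Sound G p ∅) (t : ℕ) :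
    (∀ p q k r x, .share k r x ∈ e.msg t p q → e.Honest r →
      ∃ s ≤ t, ∃ q, .share k r x ∈ e.msg s r q) ∧
    (∀ p q k x, .full k x ∈ e.msg t p q → ∃ S ⊆ G.members k, G.threshold k ≤ S.card ∧
      ∀ r ∈ S, e.Honest r → ∃ s ≤ t, ∃ q, .share k r x ∈ e.msg s r q) := by
  induction t using Nat.strong_induction_on with
  | _ t ih =>
  -- The adversary is rushing, so its messages may depend on uncorrupted ones of the same round.
  -- Uncorrupted senders, who use earlier rounds only, therefore come first. They never forward
  -- shares of others.
  have honest : ∀ p, p ∉ e.corrupt t → ∀ q,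
      (∀ k r x, .share k r x ∈ e.msg t p q → e.Honest r →
        ∃ s ≤ t, ∃ q, .share k r x ∈ e.msg s r q) ∧
      (∀ k x, .full k x ∈ e.msg t p q → ∃ S ⊆ G.members k, G.threshold k ≤ S.card ∧
        ∀ r ∈ S, e.Honest r → ∃ s ≤ t, ∃ q, .share k r x ∈ e.msg s r q) := by
    intro p hp q
    have hav := fun a (ha : a ∈ e.msg t p q) =>
      (sound_state e hstart hp).available (by rwa [msg_eq_out e hp] at ha)
    constructor
    · intro k r x hm _
      obtain ⟨rfl, -⟩ := hav _ hm
      exact ⟨t, le_rfl, q, hm⟩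
    · intro k x hm
      rcases hav _ hm with ⟨s, hs, r, hr⟩ | ⟨S, hS, hcard, hr⟩
      · obtain ⟨S, hS, hcard, h⟩ := (ih s hs).2 _ _ _ _ hr
        refine ⟨S, hS, hcard, fun r hr hH => ?_⟩
        obtain ⟨s', hs', h'⟩ := h r hr hH
        exact ⟨s', hs'.trans hs.le, h'⟩
      · refine ⟨S, hS, hcard, fun r hrS hH => ?_⟩
        obtain ⟨s, hs, r', hr'⟩ := hr r hrS
        obtain ⟨s', hs', h'⟩ := (ih s hs).1 _ _ _ _ _ hr' hH
        exact ⟨s', hs'.trans hs.le, h'⟩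
  have seen : ∀ p q, ∀ a ∈ e.msg t p q,
      (∀ k r x, a = .share k r x → e.Honest r → ∃ s ≤ t, ∃ q, .share k r x ∈ e.msg s r q) ∧
      (∀ k x, a = .full k x → ∃ S ⊆ G.members k, G.threshold k ≤ S.card ∧
        ∀ r ∈ S, e.Honest r → ∃ s ≤ t, ∃ q, .share k r x ∈ e.msg s r q) := by
    intro p q a ha
    by_cases hp : p ∈ e.corrupt t
    · refine signed_of_derivable (fun r hr hH => hH t hr) ?_ ?_ (e.unforgeable t p hp q a ha)
      · rintro k r x ⟨s, hs, r', hr', q', hm⟩ hH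
        rcases hs.lt_or_eq with hs | rfl
        · obtain ⟨s', hs', h'⟩ := (ih s hs).1 _ _ _ _ _ hm hH
          exact ⟨s', hs'.trans hs.le, h'⟩
        · exact (honest r' hr' q').1 k r x hm hH
      · rintro k x ⟨s, hs, r', hr', q', hm⟩
        rcases hs.lt_or_eq with hs | rfl
        · obtain ⟨S, hS, hcard, h⟩ := (ih s hs).2 _ _ _ _ hm
          refine ⟨S, hS, hcard, fun r hr hH => ?_⟩
          obtain ⟨s', hs', h'⟩ := h r hr hH
          exact ⟨s', hs'.trans hs.le, h'⟩
        · exact (honest r' hr' q').2 k x hm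
    · refine ⟨?_, ?_⟩
      · rintro k r x rfl
        exact (honest p hp q).1 k r x ha
      · rintro k x rfl
        exact (honest p hp q).2 k x ha
  exact ⟨fun p q k r x hm => (seen p q _ hm).1 k r x rfl,
    fun p q k x hm => (seen p q _ hm).2 k x rfl⟩

/-- `CostLe` bounds the cost for arbitrary received messages, so the adversary's choices do not
matter; from the round of its corruption on, a party contributes nothing. -/
theorem sum_msg_size_le {κ : ℕ} {p : Fin n} (T : ℕ) : ∀ {t b : ℕ},
    (e.state t p : Program n V).CostLe κ b →
    ∑ i ∈ Finset.range T, (if p ∈ e.corrupt (t + i) then 0 else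
      ∑ q, (e.msg (t + i) p q).size κ) ≤ b := by
  induction T with
  | zero => simp
  | succ T ih =>
    intro t b h
    by_cases hp : p ∈ e.corrupt t
    · rw [Finset.sum_eq_zero]
      · exact Nat.zero_le b
      · intro i _
        rw [if_pos (e.corrupt_mono (Nat.le_add_right t i) hp)]
    · rw [Finset.sum_range_succ', Nat.add_zero, if_neg hp]
      simp only [msg_eq_out e hp]
      have hs := state_succ_eq_step e hp
      cases hst : (e.state t p : Program n V) with
      | halt v =>
        have hb : (e.state (t + 1) p : Program n V).CostLe κ b := by rw [hs, hst]; trivial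
        have := ih hb
        simpa [Program.out, Msg.size, add_assoc, add_comm 1] using this
      | comm out next =>
        rw [hst] at h hs
        obtain ⟨b', h₁, h₂⟩ := h
        have hb : (e.state (t + 1) p : Program n V).CostLe κ b' := by rw [hs]; exact h₂ _
        have := ih hb
        simp only [add_assoc, add_comm 1] at this
        simp only [Program.out]
        omega

theorem communicationAtMost_of_costLe {κ b : ℕ} (h : ∀ p v, (start p v).CostLe κ b) :
    (Program.protocol G start).CommunicationAtMost f κ (n * b) := by
  intro input e T
  calc e.bitsSent κ T
      = ∑ p, ∑ t ∈ Finset.range T, (if p ∈ e.corrupt (0 + t) then 0 else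
          ∑ q, (e.msg (0 + t) p q).size κ) := by
        rw [Execution.bitsSent, Finset.sum_comm]
        refine Finset.sum_congr rfl fun t _ => ?_
        simp only [zero_add]
        rw [Finset.sum_ite, Finset.sum_const_zero, zero_add]
        exact Finset.sum_congr (by ext; simp) fun _ _ => rfl
    _ ≤ ∑ _p : Fin n, b := Finset.sum_le_sum fun p _ =>
        sum_msg_size_le e T (by rw [e.state_zero]; exact h p (input p))
    _ = n * b := by simp

end Execution

/-! ### The protocol, its soundness and its cost. -/

section Agreement

variable {n : ℕ} {V : Type}

open Classical in
/-- The message `m`, sent by the members of `A` to the members of `B`. -/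
noncomputable def multicast (A B : Finset (Fin n)) (p : Fin n) (m : Msg n) (q : Fin n) : Msg n :=
  if p ∈ A ∧ q ∈ B then m else []

theorem multicast_of_mem {A B : Finset (Fin n)} {p q : Fin n} (hp : p ∈ A) (hq : q ∈ B)
    (m : Msg n) : multicast A B p m q = m := if_pos ⟨hp, hq⟩

theorem mem_of_mem_multicast {A B : Finset (Fin n)} {p q : Fin n} {m : Msg n} {a : Atom n}
    (h : a ∈ multicast A B p m q) : p ∈ A ∧ a ∈ m := by
  unfold multicast at h
  split_ifs at h with h'
  · exact ⟨h'.1, h⟩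
  · simp at h

theorem sum_size_multicast_le {κ b : ℕ} (A B : Finset (Fin n)) (p : Fin n) {m : Msg n}
    (hm : m.size κ ≤ b) :
    ∑ q, (multicast A B p m q).size κ ≤ if p ∈ A then B.card * b else 0 := by
  unfold multicast
  split_ifs with hp
  · simp only [hp, true_and]
    calc ∑ q, (if q ∈ B then m else []).size κ = ∑ q, if q ∈ B then m.size κ else 0 :=
          Finset.sum_congr rfl fun q _ => by split_ifs <;> simp [Msg.size]
      _ = B.card * m.size κ := by simp [Finset.sum_ite_mem]
      _ ≤ B.card * b := Nat.mul_le_mul_left _ hm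
  · simp [hp, Msg.size]

/-- The received messages contain enough signatures for a threshold signature of `x`. -/
def Quorum (G : ThresholdSetup n) (k : Bits) (m : Fin n → Msg n) (x : Bits) : Prop :=
  ∃ S ⊆ G.members k, G.threshold k ≤ S.card ∧ ∀ r ∈ S, .share k r x ∈ m r

/-- The received messages contain a threshold signature of `x`. -/
def Seen (k : Bits) (m : Fin n → Msg n) (x : Bits) : Prop :=
  ∃ r, .full k x ∈ m r

variable (G : ThresholdSetup n) (enc : V → Bits)

open Classical in
noncomputable def certified (k : Bits) (m : Fin n → Msg n) : Option V :=
  if h : ∃ w, Quorum G k m (enc w) then some h.choose else none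

def certificate (k : Bits) : Option V → Msg n
  | some w => [.full k (enc w)]
  | none => []

open Classical in
/-- Two threshold signatures of different values, if there are such among the received messages. -/
noncomputable def conflict (k : Bits) (m : Fin n → Msg n) : Msg n :=
  if h : ∃ w : V × V, w.1 ≠ w.2 ∧ Seen k m (enc w.1) ∧ Seen k m (enc w.2) then
    [.full k (enc h.choose.1), .full k (enc h.choose.2)] else []

open Classical in
/-- A value with a threshold signature among the received messages, by default `v`. -/
noncomputable def seenValue (k : Bits) (m : Fin n → Msg n) (v : V) : V :=
  if h : ∃ w, Seen k m (enc w) then h.choose else v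

open Classical in
/-- The value reported by more than half of the parties in `Q`, by default `v`. -/
noncomputable def majority (Q : Finset (Fin n)) (m : Fin n → Msg n) (v : V) : V :=
  if h : ∃ w, Q.card < 2 * (Q.filter fun r => m r = (enc w).map .bit).card then h.choose else v

/-- Graded agreement of the members of the key `k` on a value and a grade. -/
noncomputable def gradedAgreement (k : Bits) (p : Fin n) (v : V)
    (next : V → Prop → Program n V) : Program n V :=
  .comm (multicast (G.members k) (G.members k) p [.share k p (enc v)]) fun m₁ =>
  .comm (multicast (G.members k) (G.members k) p (certificate enc k (certified G enc k m₁)))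
    fun m₂ =>
  .comm (multicast (G.members k) (G.members k) p (conflict enc k m₂)) fun m₃ =>
  next (seenValue enc k m₂ v) (∃ w, certified G enc k m₁ = some w ∧
    ∀ w', Seen k m₂ (enc w') ∨ Seen k m₃ (enc w') → w' = w)

open Classical in
/-- Graded agreement among the members of `k`, followed by agreement `sub` on the results among the
members of `k'`, whose decision is adopted by those that have grade `0`. -/
noncomputable def phase (k k' : Bits) (sub : Fin n → V → (V → Program n V) → Program n V)
    (p : Fin n) (v : V) (next : V → Program n V) : Program n V :=
  gradedAgreement G enc k p v fun w g => sub p w fun a =>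
  .comm (multicast (G.members k') (G.members k) p ((enc a).map .bit)) fun m =>
  next (if g then w else majority enc (G.members k') m w)

/-- Byzantine agreement in the committee `P`, by recursion on its halves. -/
noncomputable def agreement (enc : V → Bits) :
    ℕ → Bits → Fin n → V → (V → Program n V) → Program n V
  | 0, _, _, v, next => next v
  | d + 1, P, p, v, next =>
    if ((majoritySetup n).members P).card ≤ 1 then next v else
      phase (majoritySetup n) enc (false :: false :: P) (false :: true :: P)
        (agreement enc d (false :: true :: P)) p v fun w =>
      phase (majoritySetup n) enc (true :: false :: P) (true :: true :: P)
        (agreement enc d (true :: true :: P)) p w next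

namespace Program

variable {G enc}

theorem Sound.multicast {p : Fin n} {K : Set (Atom n)} {A B : Finset (Fin n)} {msg : Msg n}
    {next : (Fin n → Msg n) → Program n V} (hmsg : p ∈ A → ∀ a ∈ msg, Available G p K a)
    (hnext : ∀ m, (next m).Sound G p (K ∪ {b | ∃ r, b ∈ m r})) :
    (comm (multicast A B p msg) next).Sound G p K :=
  ⟨fun _ a ha => hmsg (mem_of_mem_multicast ha).1 a (mem_of_mem_multicast ha).2, hnext⟩

theorem Sound.gradedAgreement {k : Bits} {p : Fin n} {v : V} {next : V → Prop → Program n V}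
    (hnext : ∀ w g K, (next w g).Sound G p K) (K : Set (Atom n)) :
    (gradedAgreement G enc k p v next).Sound G p K := by
  refine .multicast ?_ fun m₁ => .multicast ?_ fun m₂ => .multicast ?_ fun m₃ => hnext _ _ _
  · intro hp a ha
    rw [List.mem_singleton] at ha
    subst ha
    exact ⟨rfl, hp⟩
  · intro _ a ha
    unfold certified at ha
    split_ifs at ha with h
    · simp only [certificate, List.mem_singleton] at ha
      subst ha
      obtain ⟨S, h₁, h₂, h₃⟩ := h.choose_spec
      exact Or.inr ⟨S, h₁, h₂, fun r hr => Or.inr ⟨r, h₃ r hr⟩⟩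
    · simp [certificate] at ha
  · intro _ a ha
    unfold conflict at ha
    split_ifs at ha with h
    · simp only [List.mem_cons, List.not_mem_nil, or_false] at ha
      rcases ha with rfl | rfl
      · exact Or.inl (Or.inr h.choose_spec.2.1)
      · exact Or.inl (Or.inr h.choose_spec.2.2)
    · simp at ha

theorem Sound.phase {k k' : Bits} {sub : Fin n → V → (V → Program n V) → Program n V} {p : Fin n}
    {v : V} {next : V → Program n V}
    (hsub : ∀ w K (next : V → Program n V), (∀ a K, (next a).Sound G p K) →
      (sub p w next).Sound G p K)
    (hnext : ∀ w K, (next w).Sound G p K) (K : Set (Atom n)) :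
    (phase G enc k k' sub p v next).Sound G p K := by
  refine .gradedAgreement (fun w g K => hsub _ _ _ fun a K => .multicast ?_ fun m => hnext _ _) K
  intro _ b hb
  obtain ⟨b, -, rfl⟩ := List.mem_map.1 hb
  trivial

theorem Sound.agreement (d : ℕ) : ∀ {P : Bits} {p : Fin n} {v : V} {next : V → Program n V},
    (∀ w K, (next w).Sound (majoritySetup n) p K) → ∀ K : Set (Atom n),
    (agreement enc d P p v next).Sound (majoritySetup n) p K := by
  induction d with
  | zero => exact fun hnext K => hnext _ K
  | succ d ih =>
    intro P p v next hnext K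
    rw [ByzAgree.agreement]
    split_ifs
    · exact hnext _ K
    · exact .phase (fun w K next h => ih h K)
        (fun w K => .phase (fun w K next h => ih h K) hnext K) K

theorem CostLe.multicast {κ b c : ℕ} {p : Fin n} {A B : Finset (Fin n)} {msg : Msg n}
    {next : (Fin n → Msg n) → Program n V} (hmsg : msg.size κ ≤ b)
    (hnext : ∀ m, (next m).CostLe κ c) :
    (comm (multicast A B p msg) next).CostLe κ ((if p ∈ A then B.card * b else 0) + c) :=
  ⟨c, Nat.add_le_add_right (sum_size_multicast_le A B p hmsg) c, hnext⟩

/-- The factor `4` counts one share, one certificate and a conflicting pair of certificates. -/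
theorem CostLe.gradedAgreement {κ b c : ℕ} {k : Bits} {p : Fin n} {v : V}
    {next : V → Prop → Program n V} (hb : ∀ w, κ + k.length + (enc w).length ≤ b)
    (hnext : ∀ w g, (next w g).CostLe κ c) :
    (gradedAgreement G enc k p v next).CostLe κ
      ((if p ∈ G.members k then (G.members k).card * (4 * b) else 0) + c) := by
  refine CostLe.mono (.multicast (b := b) (c := _ + (_ + c)) ?_ fun m₁ =>
    .multicast (b := b) ?_ fun m₂ => .multicast (b := 2 * b) ?_ fun m₃ => hnext _ _) ?_
  · simpa [Msg.size, Atom.size] using hb v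
  · cases certified G enc k m₁ with
    | none => simp [Msg.size, certificate]
    | some w => simpa [Msg.size, certificate, Atom.size] using hb w
  · unfold conflict
    split_ifs with h
    · have h₁ := hb h.choose.1
      have h₂ := hb h.choose.2
      simp only [Msg.size, Atom.size, List.map_cons, List.map_nil, List.sum_cons, List.sum_nil]
      omega
    · simp [Msg.size]
  · split_ifs
    · linarith
    · omega

theorem size_map_bit (κ : ℕ) (x : Bits) : Msg.size κ (x.map (Atom.bit (n := n))) = x.length := by
  simp [Msg.size, Function.comp_def, Atom.size]

theorem CostLe.phase {κ b c' c : ℕ} {k k' : Bits}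
    {sub : Fin n → V → (V → Program n V) → Program n V} {p : Fin n} {v : V}
    {next : V → Program n V} (hk : G.members k' ⊆ G.members k)
    (hb : ∀ w, κ + k.length + (enc w).length ≤ b)
    (hsub : ∀ w c (next : V → Program n V), (∀ a, (next a).CostLe κ c) →
      (sub p w next).CostLe κ (c' + c))
    (hnext : ∀ w, (next w).CostLe κ c) :
    (phase G enc k k' sub p v next).CostLe κ
      ((if p ∈ G.members k then (G.members k).card * (5 * b) else 0) + (c' + c)) := by
  refine CostLe.mono (.gradedAgreement hb fun w g => hsub _ _ _ fun a =>
    .multicast (b := b) ?_ fun m => hnext _) ?_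
  · rw [size_map_bit]
    have := hb a
    omega
  · by_cases h : p ∈ G.members k'
    · rw [if_pos h, if_pos (hk h), if_pos (hk h)]
      linarith
    · rw [if_neg h]
      split_ifs
      · have : (G.members k).card * (5 * b) = (G.members k).card * (4 * b) +
          (G.members k).card * b := by ring
        omega
      · omega

/-- The bound is per party and independent of the depth: one level lengthens names by `2`, but
shrinks the committee to at most three quarters, and a geometric sum results. -/
theorem CostLe.agreement {κ u : ℕ} (hu : ∀ v, κ + (enc v).length + 8 ≤ u) (d : ℕ) :
    ∀ {P : Bits} {p : Fin n} {v : V} {next : V → Program n V} {c : ℕ},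
    P.length + 2 * d ≤ 2 * n → (∀ w, (next w).CostLe κ c) →
    (agreement enc d P p v next).CostLe κ
      ((if p ∈ (majoritySetup n).members P then
        40 * (((majoritySetup n).members P).card * (u + P.length)) else 0) + c) := by
  induction d with
  | zero => exact fun _ hnext => (hnext _).mono (Nat.le_add_left _ _)
  | succ d ih =>
    intro P p v next c hP hnext
    rw [ByzAgree.agreement]
    by_cases hcard : ((majoritySetup n).members P).card ≤ 1
    · rw [if_pos hcard]
      exact (hnext _).mono (Nat.le_add_left _ _)
    rw [if_neg hcard]
    have hP' : P.length + 2 ≤ 2 * n := by omega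
    have hchild : ∀ i w, κ + (i :: false :: P : Bits).length + (enc w).length
        ≤ u + P.length - 6 := fun i w => by
      have := hu w
      simp only [List.length_cons]
      omega
    have hsub : ∀ i, (majoritySetup n).members (i :: true :: P) ⊆
        (majoritySetup n).members (i :: false :: P) := fun i => by
      rw [members_child hP', members_key hP']
      exact half_subset _ i
    have hlen : ∀ i, (i :: true :: P : Bits).length + 2 * d ≤ 2 * n := fun i => by
      simp only [List.length_cons]; omega
    refine CostLe.mono (.phase (hsub _) (hchild _) (fun w c next h => ih (hlen _) h)
      fun w => .phase (hsub _) (hchild _) (fun w c next h => ih (hlen _) h) hnext) ?_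
    simp only [members_key hP', members_child hP', List.length_cons]
    set Q := (majoritySetup n).members P
    have hu8 := hu v
    -- The offsets are chosen so that the budget closes exactly: with `q` the size of `Q`, the two
    -- phases cost `10qx`, the recursion at most `30q(x + 8)`, and the sum is `40q(x + 6)`.
    obtain ⟨x, hx⟩ : ∃ x, u + P.length = x + 6 := ⟨u + P.length - 6, by omega⟩
    have hx' : u + (P.length + 1 + 1) = x + 8 := by omega
    rw [hx, hx', Nat.add_sub_cancel]
    have key : ∀ i, 40 * ((half Q i).card * (x + 8)) ≤ 30 * (Q.card * (x + 8)) := by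
      intro i
      have h₁ := card_half_le Q i
      have h₂ : 4 * (half Q i).card ≤ 3 * Q.card := by omega
      nlinarith [Nat.mul_le_mul_right (x + 8) h₂]
    by_cases hQ : p ∈ Q
    · simp only [hQ, if_true]
      by_cases h0 : p ∈ half Q false
      · have h1 := notMem_half_true Q h0
        simp only [h0, h1, if_true, if_false]
        nlinarith [key false]
      · simp only [h0, if_false]
        split_ifs
        · nlinarith [key true]
        · nlinarith
    · have h0 : ∀ i, p ∉ half Q i := fun i h => hQ (half_subset Q i h)
      simp [hQ, h0]

end Program

end Agreement

/-! ### Correctness within a committee with an honest majority. -/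

section Correctness

open Protocol

variable {n : ℕ} {V : Type} {G : ThresholdSetup n} {start : Fin n → V → Program n V} {f : ℕ}
  {input : Fin n → V} (e : (Program.protocol G start).Execution f input) {enc : V → Bits}

/-- More than half of the parties in `Q` are honest. -/
def HonestMajority (Q : Finset (Fin n)) : Prop :=
  ∃ H ⊆ Q, (∀ p ∈ H, e.Honest p) ∧ Q.card < 2 * H.card

/-- Some honest party has used its share of the key `k` before round `t`. -/
def SignedBefore (k : Bits) (t : ℕ) : Prop :=
  ∃ s < t, ∃ r, e.Honest r ∧ ∃ q x, .share k r x ∈ e.msg s r q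

variable {e}

theorem signedBefore_succ {k : Bits} {t : ℕ} (h : SignedBefore e k (t + 1)) :
    SignedBefore e k t ∨ ∃ r, e.Honest r ∧ ∃ q x, .share k r x ∈ e.msg t r q := by
  obtain ⟨s, hs, h⟩ := h
  rcases Nat.lt_succ_iff_lt_or_eq.1 hs with hs | rfl
  · exact Or.inl ⟨s, hs, h⟩
  · exact Or.inr h

theorem HonestMajority.exists_honest {Q S : Finset (Fin n)} (hQ : HonestMajority e Q)
    (hS : S ⊆ Q) (hcard : Q.card < 2 * S.card) : ∃ r ∈ S, e.Honest r := by
  obtain ⟨H, hHQ, hH, h⟩ := hQ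
  obtain ⟨r, hr⟩ := Finset.inter_nonempty_of_card_lt_card_add_card hS hHQ (by omega)
  rw [Finset.mem_inter] at hr
  exact ⟨r, hr.1, hH r hr.2⟩

theorem HonestMajority.half {Q : Finset (Fin n)} (hQ : HonestMajority e Q) :
    HonestMajority e (half Q false) ∨ HonestMajority e (half Q true) := by
  obtain ⟨H, hHQ, hH, h⟩ := hQ
  have h₁ := Finset.card_union_of_disjoint (disjoint_half Q)
  have h₂ := Finset.card_union_of_disjoint
    ((disjoint_half Q).mono (Finset.inter_subset_right (s₁ := H))
      (Finset.inter_subset_right (s₁ := H)))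
  rw [half_union] at h₁
  rw [← Finset.inter_union_distrib_left, half_union, Finset.inter_eq_left.2 hHQ] at h₂
  have hsub : ∀ i, ∀ p ∈ H ∩ ByzAgree.half Q i, e.Honest p :=
    fun i p hp => hH p (Finset.mem_inter.1 hp).1
  by_cases h₃ : (ByzAgree.half Q false).card < 2 * (H ∩ ByzAgree.half Q false).card
  · exact Or.inl ⟨_, Finset.inter_subset_right, hsub false, h₃⟩
  · exact Or.inr ⟨_, Finset.inter_subset_right, hsub true, by omega⟩

/-- The honest reporters alone form a majority, and any other majority contains one of them. -/
theorem majority_eq (henc : Function.Injective enc) {Q : Finset (Fin n)}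
    (hQ : HonestMajority e Q) {m : Fin n → Msg n} {a : V}
    (hm : ∀ r ∈ Q, e.Honest r → m r = (enc a).map .bit) (v : V) : majority enc Q m v = a := by
  classical
  have hex : ∃ w, Q.card < 2 * (Q.filter fun r => m r = (enc w).map .bit).card := by
    obtain ⟨H, hHQ, hH, h⟩ := hQ
    refine ⟨a, h.trans_le (Nat.mul_le_mul_left 2 (Finset.card_le_card fun r hr => ?_))⟩
    exact Finset.mem_filter.2 ⟨hHQ hr, hm r (hHQ hr) (hH r hr)⟩
  have hdef : majority enc Q m v = hex.choose := by
    unfold majority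
    rw [dif_pos (by convert hex)]
  rw [hdef]
  obtain ⟨r, hr, hH⟩ := hQ.exists_honest (Finset.filter_subset _ Q) hex.choose_spec
  rw [Finset.mem_filter, hm r hr.1 hH] at hr
  exact henc ((List.map_injective_iff.2 fun _ _ h => Atom.bit.inj h) hr.2).symm

/-- Agreement with a graded party needs neither an honest majority nor a fresh key; only validity
uses them. -/
theorem gradedAgreement_spec (henc : Function.Injective enc)
    (hstart : ∀ p v, (start p v).Sound G p ∅) {k : Bits}
    (hk : G.threshold k = (G.members k).card / 2 + 1) {t : ℕ} {v : Fin n → V}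
    {next : Fin n → V → Prop → Program n V}
    (hs : ∀ p, e.Honest p → e.state t p = gradedAgreement G enc k p (v p) (next p)) :
    ∃ (w : Fin n → V) (g : Fin n → Prop),
      (∀ p, e.Honest p → e.state (t + 3) p = next p (w p) (g p)) ∧
      (∀ k', SignedBefore e k' (t + 3) → k' ≠ k → SignedBefore e k' t) ∧
      (∀ p ∈ G.members k, e.Honest p → g p → ∀ q ∈ G.members k, e.Honest q → w q = w p) ∧
      (HonestMajority e (G.members k) → ¬ SignedBefore e k t →
        ∀ x, (∀ p ∈ G.members k, e.Honest p → v p = x) →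
          ∀ p ∈ G.members k, e.Honest p → w p = x ∧ g p) := by
  set Q := G.members k
  let m₁ : Fin n → Fin n → Msg n := fun p q => e.msg t q p
  let m₂ : Fin n → Fin n → Msg n := fun p q => e.msg (t + 1) q p
  let m₃ : Fin n → Fin n → Msg n := fun p q => e.msg (t + 2) q p
  let c : Fin n → Option V := fun p => certified G enc k (m₁ p)
  have hm₁ : ∀ p, e.Honest p → ∀ q,
      e.msg t p q = multicast Q Q p [.share k p (enc (v p))] q :=
    fun p hp q => msg_eq_of_comm e (hp t) (hs p hp) q
  have hs₁ := fun p (hp : e.Honest p) => state_succ_of_comm e (hp t) (hs p hp)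
  have hm₂ : ∀ p, e.Honest p → ∀ q,
      e.msg (t + 1) p q = multicast Q Q p (certificate enc k (c p)) q :=
    fun p hp q => msg_eq_of_comm e (hp (t + 1)) (hs₁ p hp) q
  have hs₂ := fun p (hp : e.Honest p) => state_succ_of_comm e (hp (t + 1)) (hs₁ p hp)
  have hm₃ : ∀ p, e.Honest p → ∀ q,
      e.msg (t + 2) p q = multicast Q Q p (conflict enc k (m₂ p)) q :=
    fun p hp q => msg_eq_of_comm e (hp (t + 2)) (hs₂ p hp) q
  have hs₃ := fun p (hp : e.Honest p) => state_succ_of_comm e (hp (t + 2)) (hs₂ p hp)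
  have no_share₂ : ∀ p, e.Honest p → ∀ q k' r x, .share k' r x ∉ e.msg (t + 1) p q := by
    intro p hp q k' r x h
    rw [hm₂ p hp] at h
    have h := (mem_of_mem_multicast h).2
    cases hc : c p <;> simp [certificate, hc] at h
  have no_share₃ : ∀ p, e.Honest p → ∀ q k' r x, .share k' r x ∉ e.msg (t + 2) p q := by
    intro p hp q k' r x h
    rw [hm₃ p hp] at h
    have h := (mem_of_mem_multicast h).2
    unfold conflict at h
    split_ifs at h <;> simp at h
  refine ⟨fun p => seenValue enc k (m₂ p) (v p), fun p => ∃ w, c p = some w ∧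
    ∀ w', Seen k (m₂ p) (enc w') ∨ Seen k (m₃ p) (enc w') → w' = w, hs₃, ?_, ?_, ?_⟩
  · intro k' h hk'
    rcases signedBefore_succ h with h | ⟨r, hr, q, x, h⟩
    · rcases signedBefore_succ h with h | ⟨r, hr, q, x, h⟩
      · rcases signedBefore_succ h with h | ⟨r, hr, q, x, h⟩
        · exact h
        · rw [hm₁ r hr] at h
          have h := (mem_of_mem_multicast h).2
          simp only [List.mem_singleton, Atom.share.injEq] at h
          exact absurd h.1 hk'
      · exact absurd h (no_share₂ r hr _ _ _ _)
    · exact absurd h (no_share₃ r hr _ _ _ _)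
  · rintro p hpQ hp ⟨w, hw, huniq⟩
    have hval : ∀ q ∈ Q, e.Honest q → seenValue enc k (m₂ q) (v q) = w := by
      intro q hqQ hq
      have hseen : Seen k (m₂ q) (enc w) := by
        refine ⟨p, ?_⟩
        change _ ∈ e.msg (t + 1) p q
        rw [hm₂ p hp, multicast_of_mem hpQ hqQ, hw]
        simp [certificate]
      have hex : ∃ w, Seen k (m₂ q) (enc w) := ⟨w, hseen⟩
      rw [seenValue, dif_pos hex]
      -- Having seen a second certified value, `q` would have sent a conflicting pair to `p`. The
      -- grade of `p` forces both values of the pair to be `w`.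
      by_contra hne
      have hconf : ∃ w : V × V, w.1 ≠ w.2 ∧ Seen k (m₂ q) (enc w.1) ∧ Seen k (m₂ q) (enc w.2) :=
        ⟨(hex.choose, w), hne, hex.choose_spec, hseen⟩
      have hmsg : e.msg (t + 2) q p =
          [.full k (enc hconf.choose.1), .full k (enc hconf.choose.2)] := by
        rw [hm₃ q hq, multicast_of_mem hqQ hpQ, conflict, dif_pos hconf]
      refine hconf.choose_spec.1 ((huniq _ (Or.inr ⟨q, ?_⟩)).trans (huniq _ (Or.inr ⟨q, ?_⟩)).symm)
      · change _ ∈ e.msg (t + 2) q p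
        simp [hmsg]
      · change _ ∈ e.msg (t + 2) q p
        simp [hmsg]
    intro q hqQ hq
    exact (hval q hqQ hq).trans (hval p hpQ hp).symm
  · intro hmaj hfresh x hx
    have hsigned : ∀ s < t + 3, ∀ r q y, e.Honest r → .share k r y ∈ e.msg s r q → y = enc x := by
      intro s hst r q y hr h
      rcases Nat.lt_or_ge s t with hs | hs
      · exact absurd ⟨s, hs, r, hr, q, y, h⟩ hfresh
      obtain rfl | rfl | rfl : s = t ∨ s = t + 1 ∨ s = t + 2 := by omega
      · rw [hm₁ r hr] at h
        have h := mem_of_mem_multicast h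
        simp only [List.mem_singleton, Atom.share.injEq, true_and] at h
        rw [h.2, hx r h.1 hr]
      · exact absurd h (no_share₂ r hr _ _ _ _)
      · exact absurd h (no_share₃ r hr _ _ _ _)
    -- A certificate needs an honest signer, and by freshness honest parties have signed only `x`
    -- with this key.
    have hfull : ∀ s < t + 3, ∀ p q y, .full k (enc y) ∈ e.msg s p q → y = x := by
      intro s hst p q y h
      obtain ⟨S, hS, hcard, hshare⟩ := (signed_of_mem_msg e hstart s).2 p q k _ h
      obtain ⟨r, hrS, hr⟩ := hmaj.exists_honest hS (by omega)
      obtain ⟨s', hs', q', h'⟩ := hshare r hrS hr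
      exact henc (hsigned s' (by omega) r q' _ hr h')
    intro p hpQ hp
    have hquorum : ∃ w, Quorum G k (m₁ p) (enc w) := by
      obtain ⟨H, hHQ, hH, h⟩ := hmaj
      refine ⟨x, H, hHQ, by omega, fun r hr => ?_⟩
      change _ ∈ e.msg t r p
      rw [hm₁ r (hH r hr), multicast_of_mem (hHQ hr) hpQ, hx r (hHQ hr) (hH r hr)]
      simp
    have hc : c p = some x := by
      obtain ⟨S, hS, hcard, hshare⟩ := hquorum.choose_spec
      obtain ⟨r, hrS, hr⟩ := hmaj.exists_honest hS (by omega)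
      have : hquorum.choose = x := henc (hsigned t (by omega) r p _ hr (hshare r hrS))
      change certified G enc k (m₁ p) = some x
      rw [certified, dif_pos hquorum, this]
    have hex : ∃ w, Seen k (m₂ p) (enc w) := by
      refine ⟨x, p, ?_⟩
      change _ ∈ e.msg (t + 1) p p
      rw [hm₂ p hp, multicast_of_mem hpQ hpQ, hc]
      simp [certificate]
    refine ⟨?_, x, hc, ?_⟩
    · change seenValue enc k (m₂ p) (v p) = x
      rw [seenValue, dif_pos hex]
      obtain ⟨r, hr⟩ := hex.choose_spec
      exact hfull (t + 1) (by omega) r p _ hr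
    · rintro w' (⟨r, hr⟩ | ⟨r, hr⟩)
      · exact hfull (t + 1) (by omega) r p _ hr
      · exact hfull (t + 2) (by omega) r p _ hr

variable (e) in
/-- In the execution `e`, the subprotocol `sub` takes `R` rounds, uses only keys from `K`, and, if
most of the parties in `Q` are honest and the keys are fresh, solves agreement in `Q`. -/
def Implements (Q : Finset (Fin n)) (K : Set Bits) (R : ℕ)
    (sub : Fin n → V → (V → Program n V) → Program n V) : Prop :=
  ∀ (t : ℕ) (v : Fin n → V) (next : Fin n → V → Program n V),
    (∀ p, e.Honest p → e.state t p = sub p (v p) (next p)) →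
    ∃ a : Fin n → V, (∀ p, e.Honest p → e.state (t + R) p = next p (a p)) ∧
      (∀ k, SignedBefore e k (t + R) → k ∉ K → SignedBefore e k t) ∧
      (HonestMajority e Q → (∀ k ∈ K, ¬ SignedBefore e k t) →
        (∀ x, (∀ p ∈ Q, e.Honest p → v p = x) → ∀ p ∈ Q, e.Honest p → a p = x) ∧
        ∃ x, ∀ p ∈ Q, e.Honest p → a p = x)

/-- Validity needs an honest majority in the committee only, whatever happens in the half; a common
value also needs one in the half. -/
theorem phase_spec (henc : Function.Injective enc)
    (hstart : ∀ p v, (start p v).Sound G p ∅) {k k' : Bits}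
    (hk : G.threshold k = (G.members k).card / 2 + 1) (hkk' : G.members k' ⊆ G.members k)
    {K : Set Bits} (hK : k ∉ K) {R : ℕ}
    {sub : Fin n → V → (V → Program n V) → Program n V}
    (hsub : Implements e (G.members k') K R sub) {t : ℕ} {v : Fin n → V}
    {next : Fin n → V → Program n V}
    (hs : ∀ p, e.Honest p → e.state t p = phase G enc k k' sub p (v p) (next p)) :
    ∃ a : Fin n → V, (∀ p, e.Honest p → e.state (t + (3 + R + 1)) p = next p (a p)) ∧
      (∀ k₀, SignedBefore e k₀ (t + (3 + R + 1)) → k₀ ≠ k → k₀ ∉ K → SignedBefore e k₀ t) ∧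
      (HonestMajority e (G.members k) → ¬ SignedBefore e k t → (∀ k₀ ∈ K, ¬ SignedBefore e k₀ t) →
        (∀ x, (∀ p ∈ G.members k, e.Honest p → v p = x) →
          ∀ p ∈ G.members k, e.Honest p → a p = x) ∧
        (HonestMajority e (G.members k') →
          ∃ x, ∀ p ∈ G.members k, e.Honest p → a p = x)) := by
  classical
  obtain ⟨w, g, hs₁, hsig₁, hgrade, hvalid⟩ := gradedAgreement_spec henc hstart hk hs
  obtain ⟨a, hs₂, hsig₂, hagree⟩ := hsub _ w _ hs₁
  have hm : ∀ p, e.Honest p → ∀ q, e.msg (t + 3 + R) p q =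
      multicast (G.members k') (G.members k) p ((enc (a p)).map .bit) q :=
    fun p hp q => msg_eq_of_comm e (hp _) (hs₂ p hp) q
  have hs₃ := fun p (hp : e.Honest p) => state_succ_of_comm e (hp _) (hs₂ p hp)
  refine ⟨fun p => if g p then w p else
    majority enc (G.members k') (fun q => e.msg (t + 3 + R) q p) (w p), ?_, ?_, ?_⟩
  · intro p hp
    rw [show t + (3 + R + 1) = t + 3 + R + 1 by ring, hs₃ p hp]
  · intro k₀ h h₁ h₂
    rw [show t + (3 + R + 1) = t + 3 + R + 1 by ring] at h
    rcases signedBefore_succ h with h | ⟨r, hr, q, x, h⟩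
    · exact hsig₁ k₀ (hsig₂ k₀ h h₂) h₁
    · rw [hm r hr] at h
      have h := (mem_of_mem_multicast h).2
      simp at h
  · intro hmaj hfresh hfreshK
    refine ⟨fun x hx p hpQ hp => ?_, fun hmaj' => ?_⟩
    · obtain ⟨h₁, h₂⟩ := hvalid hmaj hfresh x hx p hpQ hp
      simp only [if_pos h₂, h₁]
    have hfresh' : ∀ k₀ ∈ K, ¬ SignedBefore e k₀ (t + 3) := fun k₀ hk₀ h =>
      hfreshK k₀ hk₀ (hsig₁ k₀ h fun h' => hK (h' ▸ hk₀))
    obtain ⟨hvalid', x, hx⟩ := hagree hmaj' hfresh'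
    have hmajority : ∀ y, (∀ p ∈ G.members k', e.Honest p → a p = y) → ∀ p ∈ G.members k,
        majority enc (G.members k') (fun q => e.msg (t + 3 + R) q p) (w p) = y := by
      intro y hy p hpQ
      refine majority_eq henc hmaj' (fun r hr hrH => ?_) _
      rw [hm r hrH, multicast_of_mem hr hpQ, hy r hr hrH]
    -- If some honest member has a grade, validity of the recursive call makes the reports equal to
    -- its value, so keeping and adopting coincide.
    by_cases hg : ∃ p ∈ G.members k, e.Honest p ∧ g p
    · obtain ⟨p, hpQ, hp, hgp⟩ := hg
      have hw := hgrade p hpQ hp hgp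
      have hy := hvalid' (w p) fun q hq hqH => hw q (hkk' hq) hqH
      refine ⟨w p, fun q hqQ hq => ?_⟩
      change (if g q then w q else _) = w p
      rw [hmajority _ hy q hqQ, hw q hqQ hq, ite_self]
    · push Not at hg
      refine ⟨x, fun q hqQ hq => ?_⟩
      change (if g q then w q else _) = x
      rw [if_neg (hg q hqQ hq), hmajority x hx q hqQ]

/-- Halving a committee with at least two members removes at least one, so depth `d` suffices for
`d` members. The keys used within a committee are confined to names extending its own. -/
theorem exists_implements_agreement
    {e : (Program.protocol (majoritySetup n) start).Execution f input}
    (henc : Function.Injective enc)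
    (hstart : ∀ p v, (start p v).Sound (majoritySetup n) p ∅) (d : ℕ) :
    ∀ P : Bits, P.length + 2 * d ≤ 2 * n → ((majoritySetup n).members P).card ≤ d →
      ∃ R, Implements e ((majoritySetup n).members P) {k | P <:+ k} R (agreement enc d P) := by
  induction d with
  | zero =>
    -- An empty committee has no honest majority, so the claim is vacuous.
    refine fun P _ hcard => ⟨0, fun t v next hs => ⟨v, hs, fun k h _ => h, fun hmaj _ => ?_⟩⟩
    obtain ⟨H, hHQ, -, h⟩ := hmaj
    have := Finset.card_le_card hHQ
    omega
  | succ d ih =>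
    intro P hP hcard
    set Q := (majoritySetup n).members P with hQ
    by_cases hQ1 : Q.card ≤ 1
    · refine ⟨0, fun t v next hs => ⟨v, fun p hp => ?_, fun k h _ => h, fun hmaj _ =>
        ⟨fun x hx => hx, ?_⟩⟩⟩
      · rw [Nat.add_zero, hs p hp, agreement, if_pos hQ1]
      · obtain ⟨H, hHQ, hH, h⟩ := hmaj
        obtain ⟨r, hr⟩ : H.Nonempty := Finset.card_pos.1 (by omega)
        exact ⟨v r, fun p hp _ => by rw [Finset.card_le_one.1 hQ1 p hp r (hHQ hr)]⟩
    have hP' : P.length + 2 ≤ 2 * n := by omega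
    have hchild : ∀ i, ((majoritySetup n).members (i :: true :: P)).card ≤ d := fun i => by
      have := card_half_le Q i
      rw [members_child hP', ← hQ]
      omega
    have hsubset : ∀ i, (majoritySetup n).members (i :: true :: P) ⊆
        (majoritySetup n).members (i :: false :: P) := fun i => by
      rw [members_child hP', members_key hP']
      exact half_subset _ i
    have hlen : ∀ i, (i :: true :: P : Bits).length + 2 * d ≤ 2 * n := fun i => by
      simp only [List.length_cons]; omega
    -- The next three facts separate the keys of the two phases and of the two recursive calls;
    -- hence the first phase leaves those of the second fresh.
    have hnot : ∀ i j, (i :: false :: P) ∉ {k : Bits | (j :: true :: P) <:+ k} := fun i j h => by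
      have := List.IsSuffix.eq_of_length h (by simp)
      simp at this
    have hne : ∀ j, (true :: j :: P) ∉ {k : Bits | (false :: true :: P) <:+ k} := fun j h => by
      have := List.IsSuffix.eq_of_length h (by simp)
      simp at this
    have hdisj : ∀ k : Bits, (true :: true :: P) <:+ k → ¬ (false :: true :: P) <:+ k :=
      fun k h₁ h₂ => by
        have := (List.suffix_of_suffix_length_le h₁ h₂ (by simp)).eq_of_length (by simp)
        simp at this
    have hsuff : ∀ i j, P <:+ (i :: j :: P) := fun i j =>
      (List.suffix_cons j P).trans (List.suffix_cons i _)
    obtain ⟨R₀, hR₀⟩ := ih (false :: true :: P) (hlen _) (hchild _)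
    obtain ⟨R₁, hR₁⟩ := ih (true :: true :: P) (hlen _) (hchild _)
    refine ⟨3 + R₀ + 1 + (3 + R₁ + 1), fun t v next hs => ?_⟩
    obtain ⟨a, hs₀, hsig₀, hag₀⟩ := phase_spec (v := v) henc hstart
      (threshold_majoritySetup n (false :: false :: P)) (hsubset false) (hnot false false) hR₀
      (fun p hp => by rw [hs p hp, agreement, if_neg hQ1])
    obtain ⟨b, hs₁, hsig₁, hag₁⟩ := phase_spec (v := a) henc hstart
      (threshold_majoritySetup n (true :: false :: P)) (hsubset true) (hnot true true) hR₁ hs₀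
    simp only [members_key hP', members_child hP', ← hQ] at hag₀ hag₁
    refine ⟨b, fun p hp => by rw [← hs₁ p hp, add_assoc t], fun k h hk => ?_, fun hmaj hfresh => ?_⟩
    · rw [← add_assoc] at h
      have hne' : ∀ i j, k ≠ i :: j :: P := fun i j h => hk (h ▸ hsuff i j)
      have hns : ∀ i j, ¬ (i :: j :: P) <:+ k := fun i j h => hk ((hsuff i j).trans h)
      exact hsig₀ k (hsig₁ k h (hne' _ _) (hns _ _)) (hne' _ _) (hns _ _)
    · have hag₀ := hag₀ hmaj (hfresh _ (hsuff _ _)) fun k hk => hfresh k ((hsuff _ _).trans hk)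
      have hag₁ := hag₁ hmaj
        (fun h => hfresh _ (hsuff _ _) (hsig₀ _ h (by simp) (hne false)))
        (fun k hk h => hfresh k ((hsuff _ _).trans hk) (hsig₀ k h
          (fun h' => hnot false true (h' ▸ hk)) (hdisj k hk)))
      refine ⟨fun x hx => hag₁.1 x (hag₀.1 x hx), ?_⟩
      -- A good first half gives agreement that the second phase preserves by validity; a good
      -- second half gives it directly.
      rcases hmaj.half with h | h
      · obtain ⟨x, hx⟩ := hag₀.2 h
        exact ⟨x, hag₁.1 x hx⟩
      · exact hag₁.2 h

end Correctness

/-! ### Agreement among all parties and the final bound. -/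

/-- Byzantine agreement among all parties. -/
noncomputable def byzantineAgreement (n : ℕ) {V : Type} (enc : V → Bits) : Protocol n V :=
  Program.protocol (majoritySetup n) fun p v => agreement enc n [] p v .halt

/-- There are finitely many parties, so some round comes after all corruptions, and the bound `f` at
that round counts every party that is ever corrupted. -/
theorem exists_honest_majority {n : ℕ} {V : Type} {P : Protocol n V} {f : ℕ} {input : Fin n → V}
    (e : P.Execution f input) (hf : 2 * f < n) :
    ∃ H : Finset (Fin n), (∀ p ∈ H, e.Honest p) ∧ n < 2 * H.card := by
  have h : ∀ p, ∃ t, ¬ e.Honest p → p ∈ e.corrupt t := by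
    intro p
    by_cases hp : e.Honest p
    · exact ⟨0, fun h => absurd hp h⟩
    · simp only [Protocol.Execution.Honest, not_forall, not_not] at hp
      exact hp.imp fun t ht _ => ht
  choose T hT using h
  refine ⟨(e.corrupt (∑ p, T p))ᶜ, fun p hp => by_contra fun h => Finset.mem_compl.1 hp
    (e.corrupt_mono (Finset.single_le_sum (fun _ _ => Nat.zero_le _) (Finset.mem_univ p))
      (hT p h)), ?_⟩
  have := e.corrupt_card (∑ p, T p)
  rw [Finset.card_compl, Fintype.card_fin]
  omega

section byzantineAgreement

variable {n : ℕ} {V : Type} {enc : V → Bits}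

theorem sound_agreement_halt (p : Fin n) (v : V) :
    (agreement enc n [] p v .halt).Sound (majoritySetup n) p ∅ :=
  Program.Sound.agreement n (next := .halt) (fun _ _ => trivial) ∅

theorem byzantineAgreement_realizable (f : ℕ) : (byzantineAgreement n enc).Realizable f :=
  realizable_of_sound sound_agreement_halt

theorem byzantineAgreement_outcome (henc : Function.Injective enc) {f : ℕ} (hf : 2 * f < n)
    {input : Fin n → V} (e : (byzantineAgreement n enc).Execution f input) :
    ∃ x, (∀ p, e.Honest p → ∀ w, e.Decides p w ↔ w = x) ∧
      ∀ y, (∀ p, e.Honest p → input p = y) → x = y := by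
  obtain ⟨R, hR⟩ := exists_implements_agreement (e := e) henc sound_agreement_halt n []
    (by simp) (by simp [members_nil])
  obtain ⟨a, hs, -, ha⟩ := hR 0 input (fun _ => .halt) fun p _ => e.state_zero p
  obtain ⟨H, hH, hcard⟩ := exists_honest_majority e hf
  obtain ⟨hvalid, x, hx⟩ := ha ⟨H, by simp [members_nil], hH, by simpa [members_nil] using hcard⟩
    (fun k _ ⟨s, hs, _⟩ => absurd hs (Nat.not_lt_zero s))
  simp only [members_nil, Finset.mem_univ, true_implies] at hvalid hx
  refine ⟨x, fun p hp w => ?_, fun y hy => ?_⟩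
  · rw [← hx p hp]
    exact decides_iff_of_halt e hp (hs p hp)
  · obtain ⟨p, hp⟩ : H.Nonempty := Finset.card_pos.1 (by omega)
    rw [← hx p (hH p hp), hvalid y hy p (hH p hp)]

theorem byzantineAgreement_solvesBA (henc : Function.Injective enc) {f : ℕ} (hf : 2 * f < n) :
    (byzantineAgreement n enc).SolvesBA f where
  consistency input e p q v w hp hq hv hw := by
    obtain ⟨x, hx, -⟩ := byzantineAgreement_outcome henc hf e
    rw [(hx p hp v).1 hv, (hx q hq w).1 hw]
  termination input e p hp := by
    obtain ⟨x, hx, -⟩ := byzantineAgreement_outcome henc hf e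
    exact ⟨x, (hx p hp x).2 rfl⟩
  validity input e v hv p hp := by
    obtain ⟨x, hx, hxv⟩ := byzantineAgreement_outcome henc hf e
    exact (hx p hp v).2 (hxv v hv).symm

theorem byzantineAgreement_communicationAtMost {κ b : ℕ} (hb : ∀ v, (enc v).length ≤ b) (f : ℕ) :
    (byzantineAgreement n enc).CommunicationAtMost f κ (n * (40 * (n * (κ + b + 8)))) := by
  refine communicationAtMost_of_costLe fun p v => ?_
  have h := Program.CostLe.agreement (enc := enc) (κ := κ) (u := κ + b + 8)
    (fun v => by have := hb v; omega) n (P := []) (p := p) (v := v) (next := .halt) (c := 0)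
    (by simp) (fun _ => trivial)
  simpa [members_nil] using h

end byzantineAgreement

end ByzAgree

theorem theorem1 (c : ℕ) :
    ∃ C : ℕ, ∀ (n f κ : ℕ), 2 * f < n → 1 ≤ κ →
      ∀ (V : Type) (enc : V → ByzAgree.Bits), Function.Injective enc →
        (∀ v, (enc v).length ≤ c * κ) →
        ∃ P : ByzAgree.Protocol n V,
          P.Realizable f ∧ P.SolvesBA f ∧ P.CommunicationAtMost f κ (C * (κ * n ^ 2)) := by
  refine ⟨40 * (c + 9), fun n f κ hf hκ V enc henc hlen => ⟨ByzAgree.byzantineAgreement n enc,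
    ByzAgree.byzantineAgreement_realizable f, ByzAgree.byzantineAgreement_solvesBA henc hf,
    fun input e T =>
      (ByzAgree.byzantineAgreement_communicationAtMost hlen f input e T).trans ?_⟩⟩
  -- The additive `8` is absorbed using `1 ≤ κ`, which gives `1 + c + 8 = c + 9`.
  calc n * (40 * (n * (κ + c * κ + 8))) ≤ n * (40 * (n * (κ + c * κ + 8 * κ))) := by
        gcongr
        omega
    _ = 40 * (c + 9) * (κ * n ^ 2) := by ring
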